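/- Let $a>0$ and $\bar b>0$ be real numbers, let $p\ge 1$ be an integer, and put $T=2p\pi/\sqrt a$. Let $f,g:\mathbb R^3\to\mathbb R$, $(t,\theta,\omega)\mapsto f(t,\theta,\omega),\,g(t,\theta,\omega)$, be smooth ($C^\infty$) and $T$-periodic in $t$, and assume $f(t,0,0)=0$ for all $t$. For $\varepsilon>0$ consider the perturbed damped pendulum with damping $b=\varepsilon\bar b$, $$\ddot\theta=-a\sin\theta-\varepsilon\bar b\,\dot\theta+\varepsilon f(t,\theta,\dot\theta)+\varepsilon^2 g(t,\theta,\dot\theta).\qquad(*)$$ Write $g_0(t)=g(t,0,0)$, $f_1(t)=\frac{\partial f}{\partial\theta}(t,0,0)$, $f_2(t)=\frac{\partial f}{\partial\omega}(t,0,0)$, and let $M=(M_{ij})$ be the $2\times2$ matrix and $v\in\mathbb R^2$ the vector given by $$M_{11}=-\frac{\bar b\,p\,\pi}{\sqrt a}+\int_0^{T}\sin(\sqrt a t)\left(-\frac{\cos(\sqrt a t)}{\sqrt a}f_1(t)+\sin(\sqrt a t)f_2(t)\right)dt,$$ $$M_{12}=\int_0^{T}\frac{\sin(\sqrt a t)}{a}\left(-\sin(\sqrt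 a t)f_1(t)-\sqrt a\cos(\sqrt a t)f_2(t)\right)dt,$$ $$M_{21}=\int_0^{T}\cos(\sqrt a t)\left(\cos(\sqrt a t)f_1(t)-\sqrt a\sin(\sqrt a t)f_2(t)\right)dt,$$ $$M_{22}=-\frac{\bar b\,p\,\pi}{\sqrt a}+\int_0^{T}\cos(\sqrt a t)\left(\frac{\sin(\sqrt a t)}{\sqrt a}f_1(t)+\cos(\sqrt a t)f_2(t)\right)dt,$$ $$v=\left(\int_0^{T}\frac{\sin(\sqrt a t)}{\sqrt a}g_0(t)\,dt,\ -\int_0^{T}\cos(\sqrt a t)g_0(t)\,dt\right).$$ If $\det M\neq0$ and $v\neq(0,0)$, then there is $\varepsilon_0>0$ such that for every $\varepsilon\in(0,\varepsilon_0)$ the equation $(*)$ has a $T$-periodic solution $\theta(\cdot,\varepsilon):\mathbb R\to\mathbb R$, and these solutions can be chosen so that $(\theta(0,\varepsilon),\dot\theta(0,\varepsilon))\to(0,0)$ as $\varepsilon\to0^+$. -/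

import Mathlib

open scoped ContDiff Topology

noncomputable section

namespace PerturbedPendulum

/-- A function of time, angle and angular velocity, smooth jointly in its three variables. -/
def IsSmooth (h : ℝ → ℝ → ℝ → ℝ) : Prop :=
  ContDiff ℝ ∞ (fun x : ℝ × ℝ × ℝ => h x.1 x.2.1 x.2.2)

/-- The period `T = 2 p π / √a`. -/
def period (a : ℝ) (p : ℕ) : ℝ := 2 * p * Real.pi / √a

/-- `g₀(t) = g(t, 0, 0)`. -/
def g₀ (g : ℝ → ℝ → ℝ → ℝ) (t : ℝ) : ℝ := g t 0 0

/-- `f₁(t)`, the partial derivative of `f` in the angle at `(t, 0, 0)`. -/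
def f₁ (f : ℝ → ℝ → ℝ → ℝ) (t : ℝ) : ℝ := deriv (fun q => f t q 0) 0

/-- `f₂(t)`, the partial derivative of `f` in the angular velocity at `(t, 0, 0)`. -/
def f₂ (f : ℝ → ℝ → ℝ → ℝ) (t : ℝ) : ℝ := deriv (fun w => f t 0 w) 0

/-- The matrix `M` of the averaged linear system `M z = v`. -/
def M (a bbar : ℝ) (p : ℕ) (f : ℝ → ℝ → ℝ → ℝ) : Matrix (Fin 2) (Fin 2) ℝ :=
  !![-(bbar * p * Real.pi / √a) +
        ∫ t in (0 : ℝ)..period a p, Real.sin (√a * t) *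
          (-(Real.cos (√a * t) / √a) * f₁ f t + Real.sin (√a * t) * f₂ f t),
      ∫ t in (0 : ℝ)..period a p, Real.sin (√a * t) / a *
          (-(Real.sin (√a * t)) * f₁ f t - √a * Real.cos (√a * t) * f₂ f t);
      ∫ t in (0 : ℝ)..period a p, Real.cos (√a * t) *
          (Real.cos (√a * t) * f₁ f t - √a * Real.sin (√a * t) * f₂ f t),
      -(bbar * p * Real.pi / √a) +
        ∫ t in (0 : ℝ)..period a p, Real.cos (√a * t) *
          (Real.sin (√a * t) / √a * f₁ f t + Real.cos (√a * t) * f₂ f t)]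

/-- The right-hand side `v` of the averaged linear system `M z = v`. -/
def v (a : ℝ) (p : ℕ) (g : ℝ → ℝ → ℝ → ℝ) : Fin 2 → ℝ :=
  ![∫ t in (0 : ℝ)..period a p, Real.sin (√a * t) / √a * g₀ g t,
    -∫ t in (0 : ℝ)..period a p, Real.cos (√a * t) * g₀ g t]

/-- `θ` is a (classical, globally defined) solution of
`θ'' = -a sin θ - b θ' + ε f(t, θ, θ') + ε² g(t, θ, θ')`. -/
def IsSolution (a b ε : ℝ) (f g : ℝ → ℝ → ℝ → ℝ) (θ : ℝ → ℝ) : Prop :=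
  Differentiable ℝ θ ∧
    ∀ t : ℝ, HasDerivAt (deriv θ)
      (-a * Real.sin (θ t) - b * deriv θ t + ε * f t (θ t) (deriv θ t) +
        ε ^ 2 * g t (θ t) (deriv θ t)) t

end PerturbedPendulum

end

/-!
With `θ = ε x` the equation becomes `x'' + a x = ε (f₁ x + (f₂ - b̄) x' + g₀ + n)`, where the
remainder `n = n(ε, t, x, x')` vanishes at `x = x' = 0` (this uses `f(t, 0, 0) = 0`) and is
`O(ε)`-Lipschitz on bounded sets. Since `T` is a multiple of the period `2π / √a` of the
unperturbed linear oscillator, passing to the initial conditions `w` of the oscillator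
(variation of constants) preserves `T`-periodicity and leads to
`w' = ε (A(t) w + c(t) + N(ε, t, w))`, with `∫₀ᵀ A = M` and `∫₀ᵀ c = -v`. The averaged equation
is `M z = v`.

That such an equation has a bounded family of `T`-periodic solutions when the mean of `A` is
invertible is `exists_periodic_of_averaged_equation`. No differentiable dependence of the flow on
initial conditions is needed: writing `w = z + √ε r` with `z` constant and `r` periodic, a periodic
solution is a fixed point of a map on `ℝ² × C(ℝ/Tℤ, ℝ²)` which has Lipschitz constant `O(√ε)` on a
unit ball about `(M⁻¹ v, 0)` and moves its centre by `O(√ε)`. As `w` stays bounded,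
`(θ(0), θ'(0)) = O(ε)`.

The remainder is estimated by `exists_forceRemainder_lipschitz`, the mean of `A` is computed in
`integral_linearForce_smul_pulledForce`, and the change of variables is
`hasDerivAt_freeAngle_and_freeVelocity`.
-/

namespace PerturbedPendulum

open MeasureTheory intervalIntegral Set

/-! ### Periodic functions and their periodic primitives -/

section Averaging

variable {E : Type*} [NormedAddCommGroup E]

/-- The function on the circle `ℝ / Tℤ` induced by a continuous `T`-periodic function. -/
def periodicLift {T : ℝ} (φ : ℝ → E) (hφ : Continuous φ) (hT : Function.Periodic φ T) :
    C(AddCircle T, E) where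
  toFun := hT.lift
  continuous_toFun := continuous_coinduced_dom.mpr hφ

@[simp]
lemma periodicLift_coe {T : ℝ} (φ : ℝ → E) (hφ : Continuous φ) (hT : Function.Periodic φ T)
    (t : ℝ) : periodicLift φ hφ hT (t : AddCircle T) = φ t := rfl

lemma exists_mem_Icc_coe_eq {T : ℝ} (hT : 0 < T) (x : AddCircle T) :
    ∃ t ∈ Icc 0 T, (t : AddCircle T) = x := by
  have : Fact (0 < T) := ⟨hT⟩
  have hx := AddCircle.coe_image_Icc_eq T 0
  have : x ∈ ((↑) : ℝ → AddCircle T) '' Icc 0 (0 + T) := hx ▸ mem_univ x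
  simpa using this

lemma norm_le_of_forall_mem_Icc {T : ℝ} [Fact (0 < T)] {k : C(AddCircle T, E)} {B : ℝ}
    (hB : 0 ≤ B) (h : ∀ t ∈ Icc 0 T, ‖k (t : AddCircle T)‖ ≤ B) : ‖k‖ ≤ B := by
  refine (ContinuousMap.norm_le k hB).2 fun x => ?_
  obtain ⟨t, ht, rfl⟩ := exists_mem_Icc_coe_eq Fact.out x
  exact h t ht

lemma continuous_comp_coe {T : ℝ} (k : C(AddCircle T, E)) :
    Continuous fun s : ℝ => k (s : AddCircle T) :=
  k.continuous.comp (AddCircle.continuous_mk' T)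

variable [NormedSpace ℝ E]

lemma norm_integral_coe_le {T : ℝ} [Fact (0 < T)] (k : C(AddCircle T, E)) {t : ℝ}
    (ht : t ∈ Icc 0 T) : ‖∫ s in (0 : ℝ)..t, k (s : AddCircle T)‖ ≤ T * ‖k‖ := by
  have h := norm_integral_le_of_norm_le_const (a := 0) (b := t) (C := ‖k‖)
    (f := fun s : ℝ => k (s : AddCircle T)) fun s _ => k.norm_coe_le_norm _
  refine h.trans ?_
  rw [sub_zero, abs_of_nonneg ht.1, mul_comm]
  exact mul_le_mul_of_nonneg_right ht.2 (norm_nonneg k)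

/-- The `T`-periodic primitive, vanishing at `0`, of `k` minus its mean. It is a primitive of `k`
itself when `k` has mean zero. -/
noncomputable def periodicPrimitive {T : ℝ} [Fact (0 < T)] [CompleteSpace E]
    (k : C(AddCircle T, E)) : C(AddCircle T, E) :=
  periodicLift
    (fun t => (∫ s in (0 : ℝ)..t, k (s : AddCircle T)) -
      (t / T) • ∫ s in (0 : ℝ)..T, k (s : AddCircle T))
    ((continuous_primitive (fun _ _ => (continuous_comp_coe k).intervalIntegrable _ _) 0).sub
      (by fun_prop))
    (by
      intro t
      have hT : T ≠ 0 := (Fact.out : 0 < T).ne'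
      have hper : Function.Periodic (fun s : ℝ => k (s : AddCircle T)) T := fun s => by simp
      have hint : ∀ u w : ℝ, IntervalIntegrable (fun s : ℝ => k (s : AddCircle T)) volume u w :=
        fun u w => (continuous_comp_coe k).intervalIntegrable _ _
      have h1 := hper.intervalIntegral_add_eq t 0
      rw [zero_add] at h1
      simp only
      rw [← integral_add_adjacent_intervals (hint 0 t) (hint t (t + T)), h1, add_div,
        div_self hT, add_smul, one_smul]
      abel)

variable [CompleteSpace E]

lemma periodicPrimitive_coe {T : ℝ} [Fact (0 < T)] (k : C(AddCircle T, E)) (t : ℝ) :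
    periodicPrimitive k (t : AddCircle T) = (∫ s in (0 : ℝ)..t, k (s : AddCircle T)) -
      (t / T) • ∫ s in (0 : ℝ)..T, k (s : AddCircle T) := rfl

lemma periodicPrimitive_sub {T : ℝ} [Fact (0 < T)] (k l : C(AddCircle T, E)) :
    periodicPrimitive (k - l) = periodicPrimitive k - periodicPrimitive l := by
  ext x
  obtain ⟨t, -, rfl⟩ := exists_mem_Icc_coe_eq Fact.out x
  simp only [periodicPrimitive_coe, ContinuousMap.sub_apply]
  rw [intervalIntegral.integral_sub, intervalIntegral.integral_sub, smul_sub]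
  · abel
  all_goals exact (continuous_comp_coe _).intervalIntegrable _ _

lemma norm_periodicPrimitive_le {T : ℝ} [Fact (0 < T)] (k : C(AddCircle T, E)) :
    ‖periodicPrimitive k‖ ≤ 2 * T * ‖k‖ := by
  have hT : 0 < T := Fact.out
  refine norm_le_of_forall_mem_Icc (by positivity) fun t ht => ?_
  rw [periodicPrimitive_coe]
  refine (norm_sub_le _ _).trans ?_
  have h1 := norm_integral_coe_le k ht
  have h2 := norm_integral_coe_le k (right_mem_Icc.2 hT.le)
  have h3 : ‖(t / T) • ∫ s in (0 : ℝ)..T, k (s : AddCircle T)‖ ≤ 1 * (T * ‖k‖) := by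
    rw [norm_smul]
    refine mul_le_mul ?_ h2 (norm_nonneg _) zero_le_one
    rw [Real.norm_of_nonneg (div_nonneg ht.1 hT.le)]
    exact (div_le_one hT).2 ht.2
  linarith

/-! ### Periodic solutions by averaging -/

/-- A contraction of a closed ball that moves the centre little has a fixed point there. -/
lemma exists_isFixedPt_closedBall {X : Type*} [MetricSpace X] [CompleteSpace X] {Ψ : X → X}
    {x₀ : X} {K D r : ℝ} (hK : 0 ≤ K) (hr : 0 ≤ r) (hK1 : K < 1) (hKD : K * r + D ≤ r)
    (hΨ : ∀ x ∈ Metric.closedBall x₀ r, ∀ y ∈ Metric.closedBall x₀ r,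
      dist (Ψ x) (Ψ y) ≤ K * dist x y)
    (hΨ₀ : dist (Ψ x₀) x₀ ≤ D) : ∃ x ∈ Metric.closedBall x₀ r, Ψ x = x := by
  have hx₀ : x₀ ∈ Metric.closedBall x₀ r := Metric.mem_closedBall_self hr
  have hmaps : MapsTo Ψ (Metric.closedBall x₀ r) (Metric.closedBall x₀ r) := by
    intro x hx
    have h1 := hΨ x hx x₀ hx₀
    have h2 : K * dist x x₀ ≤ K * r := mul_le_mul_of_nonneg_left hx hK
    rw [Metric.mem_closedBall]
    linarith [dist_triangle (Ψ x) (Ψ x₀) x₀]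
  have hcontr : ContractingWith K.toNNReal (hmaps.restrict Ψ _ _) := by
    refine ⟨Real.toNNReal_lt_one.2 hK1, LipschitzWith.of_dist_le_mul ?_⟩
    intro x y
    rw [Real.coe_toNNReal _ hK]
    exact hΨ x x.2 y y.2
  obtain ⟨x, hxS, hfix, -⟩ := hcontr.exists_fixedPoint'
    (Metric.isClosed_closedBall.isComplete) hmaps hx₀ (edist_ne_top _ _)
  exact ⟨x, hxS, hfix⟩

set_option maxHeartbeats 1000000 in
/-- First-order averaging for `w' = ε (A(t) w + c(t) + N(ε, t, w))` with `T`-periodic coefficients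
and `N` of order `ε`: if the mean of `A` is invertible, then for small `ε > 0` there is a
`T`-periodic solution, with initial value bounded independently of `ε`. -/
theorem exists_periodic_of_averaged_equation {T : ℝ} (hT : 0 < T) {A : ℝ → E →L[ℝ] E}
    {c : ℝ → E} {N : ℝ → ℝ → E → E} (hA : Continuous A) (hc : Continuous c)
    (hN : ∀ ε, Continuous fun x : ℝ × E => N ε x.1 x.2)
    (hAT : Function.Periodic A T) (hcT : Function.Periodic c T)
    (hNT : ∀ ε, Function.Periodic (N ε) T) (hN0 : ∀ ε t, N ε t 0 = 0)
    (hlip : ∀ R : ℝ, 0 ≤ R → ∃ C : ℝ, 0 ≤ C ∧ ∀ ε, 0 < ε → ε ≤ 1 → ∀ t ∈ Icc 0 T, ∀ x y : E,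
      ‖x‖ ≤ R → ‖y‖ ≤ R → ‖N ε t x - N ε t y‖ ≤ C * ε * ‖x - y‖)
    (L : E ≃L[ℝ] E) (hL : ∀ z, ∫ t in (0 : ℝ)..T, A t z = L z) :
    ∃ R ε₀ : ℝ, 0 < ε₀ ∧ ∀ ε, 0 < ε → ε < ε₀ → ∃ w : ℝ → E, Function.Periodic w T ∧
      (∀ t, HasDerivAt w (ε • (A t (w t) + c t + N ε t (w t))) t) ∧ ‖w 0‖ ≤ R := by
  have : Fact (0 < T) := ⟨hT⟩
  set z₀ : E := -L.symm (∫ t in (0 : ℝ)..T, c t) with hz₀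
  set R : ℝ := ‖z₀‖ + 2 with hR
  obtain ⟨C, hC, hlip⟩ := hlip R (by positivity)
  obtain ⟨α, hα⟩ := isCompact_Icc.exists_bound_of_continuousOn (s := Icc 0 T) hA.continuousOn
  obtain ⟨γ, hγ⟩ := isCompact_Icc.exists_bound_of_continuousOn (s := Icc 0 T) hc.continuousOn
  have h0 : (0 : ℝ) ∈ Icc 0 T := left_mem_Icc.2 hT.le
  have hα0 : 0 ≤ α := (norm_nonneg _).trans (hα 0 h0)
  have hγ0 : 0 ≤ γ := (norm_nonneg _).trans (hγ 0 h0)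
  set Λ : ℝ := ‖(L.symm : E →L[ℝ] E)‖ with hΛ
  have hΛ0 : 0 ≤ Λ := norm_nonneg _
  -- `δ * q`, with `δ = √ε`, will bound the Lipschitz constant of the fixed point map on the unit
  -- ball about `(z₀, 0)`, and `δ * d` the displacement of the centre.
  set q : ℝ := Λ * (T * (α + 2 * C)) + 2 * T * (2 * (α + C)) with hq
  set d : ℝ := Λ * (T * (C * ‖z₀‖)) + 2 * T * (α * ‖z₀‖ + γ + C * ‖z₀‖) with hd
  have hq0 : 0 ≤ q := by positivity
  have hd0 : 0 ≤ d := by positivity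
  refine ⟨R, (1 / (1 + q + d)) ^ 2, by positivity, fun ε hε hεlt => ?_⟩
  set δ : ℝ := √ε with hδ
  have hδ0 : 0 < δ := Real.sqrt_pos.2 hε
  have hδε : δ * δ = ε := Real.mul_self_sqrt hε.le
  have hδlt : δ < 1 / (1 + q + d) := (Real.sqrt_lt' (by positivity)).2 hεlt
  have hδ1 : δ * (1 + q + d) < 1 := by rwa [lt_div_iff₀ (by positivity)] at hδlt
  have hδq : δ * q + δ * d < 1 := by nlinarith
  have hδle : δ ≤ 1 := by nlinarith
  have hε1 : ε ≤ 1 := by nlinarith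
  have hεδ : ε ≤ δ := by nlinarith
  have hwc : ∀ x : E × C(AddCircle T, E),
      Continuous fun t : ℝ => x.1 + δ • x.2 (t : AddCircle T) := fun x =>
    continuous_const.add ((continuous_comp_coe x.2).const_smul δ)
  -- Along `w = z + δ r` the right-hand side `k` is `A z + c + m`, with `m` of order `δ`.
  obtain ⟨m, hm⟩ : ∃ m : E × C(AddCircle T, E) → C(AddCircle T, E), ∀ x (t : ℝ), m x t =
      δ • A t (x.2 (t : AddCircle T)) + N ε t (x.1 + δ • x.2 (t : AddCircle T)) :=
    ⟨fun x => periodicLift _ (((hA.clm_apply (continuous_comp_coe x.2)).const_smul δ).add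
      ((hN ε).comp (continuous_id.prodMk (hwc x)))) fun t => by simp [hAT t, hNT ε t],
      fun _ _ => rfl⟩
  obtain ⟨k, hk⟩ : ∃ k : E × C(AddCircle T, E) → C(AddCircle T, E), ∀ x (t : ℝ), k x t =
      A t (x.1 + δ • x.2 (t : AddCircle T)) + c t +
        N ε t (x.1 + δ • x.2 (t : AddCircle T)) :=
    ⟨fun x => periodicLift _ (((hA.clm_apply (hwc x)).add hc).add
      ((hN ε).comp (continuous_id.prodMk (hwc x)))) fun t => by simp [hAT t, hNT ε t, hcT t],
      fun _ _ => rfl⟩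
  -- As `∫ A z = L z`, the first component is `z - L⁻¹ ∫ k` with the `z`-dependence cancelled; it is
  -- equal to `z` exactly when `k` has mean zero, and then the second says that `(z + δ r)' = ε k`.
  let Ψ : E × C(AddCircle T, E) → E × C(AddCircle T, E) := fun x =>
    (z₀ - L.symm (∫ t in (0 : ℝ)..T, m x (t : AddCircle T)), δ • periodicPrimitive (k x))
  let x₀ : E × C(AddCircle T, E) := (z₀, 0)
  let S := Metric.closedBall x₀ 1
  have hx₀ : x₀ ∈ S := Metric.mem_closedBall_self zero_le_one
  have hbound : ∀ x ∈ S, ∀ s : AddCircle T, ‖x.1 + δ • x.2 s‖ ≤ R := by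
    intro x hx s
    rw [Metric.mem_closedBall, Prod.dist_eq, max_le_iff, dist_eq_norm, dist_eq_norm] at hx
    have h1 : ‖x.1‖ ≤ ‖z₀‖ + 1 := by
      have := norm_le_norm_add_norm_sub z₀ x.1
      linarith [hx.1, norm_sub_rev z₀ x.1]
    have h2 : ‖x.2 s‖ ≤ 1 := (x.2.norm_coe_le_norm s).trans (by simpa [x₀] using hx.2)
    have h3 : ‖δ • x.2 s‖ ≤ 1 := by
      rw [norm_smul, Real.norm_of_nonneg hδ0.le]; nlinarith [norm_nonneg (x.2 s)]
    linarith [norm_add_le x.1 (δ • x.2 s)]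
  have hdiff : ∀ x y : E × C(AddCircle T, E), ∀ s : AddCircle T,
      ‖x.2 s - y.2 s‖ ≤ dist x y ∧
      ‖(x.1 + δ • x.2 s) - (y.1 + δ • y.2 s)‖ ≤ 2 * dist x y := by
    intro x y s
    have h1 : ‖x.1 - y.1‖ ≤ dist x y := by
      rw [← dist_eq_norm]; exact le_max_left _ _
    have h2 : ‖x.2 s - y.2 s‖ ≤ dist x y := by
      rw [← ContinuousMap.sub_apply]
      refine ((x.2 - y.2).norm_coe_le_norm s).trans ?_
      rw [← dist_eq_norm]; exact le_max_right _ _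
    refine ⟨h2, ?_⟩
    have h3 : (x.1 + δ • x.2 s) - (y.1 + δ • y.2 s) = (x.1 - y.1) + δ • (x.2 s - y.2 s) := by
      rw [smul_sub]; abel
    rw [h3]
    refine (norm_add_le _ _).trans ?_
    rw [norm_smul, Real.norm_of_nonneg hδ0.le]
    nlinarith [norm_nonneg (x.2 s - y.2 s)]
  have hNdiff : ∀ x ∈ S, ∀ y ∈ S, ∀ t ∈ Icc 0 T,
      ‖N ε t (x.1 + δ • x.2 (t : AddCircle T)) - N ε t (y.1 + δ • y.2 (t : AddCircle T))‖ ≤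
        C * ε * (2 * dist x y) := fun x hx y hy t ht =>
    (hlip ε hε hε1 t ht _ _ (hbound x hx _) (hbound y hy _)).trans
      (mul_le_mul_of_nonneg_left (hdiff x y _).2 (by positivity))
  have hmdiff : ∀ x ∈ S, ∀ y ∈ S, ‖m x - m y‖ ≤ δ * (α + 2 * C) * dist x y := by
    intro x hx y hy
    refine norm_le_of_forall_mem_Icc (by positivity) fun t ht => ?_
    simp only [hm, ContinuousMap.sub_apply]
    rw [add_sub_add_comm, ← smul_sub, ← map_sub]
    refine (norm_add_le _ _).trans ?_
    rw [norm_smul, Real.norm_of_nonneg hδ0.le]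
    have h1 := (A t).le_of_opNorm_le_of_le (hα t ht) (hdiff x y (t : AddCircle T)).1
    have h2 := hNdiff x hx y hy t ht
    have h3 : C * ε * (2 * dist x y) ≤ C * δ * (2 * dist x y) := by gcongr
    have h4 := mul_le_mul_of_nonneg_left h1 hδ0.le
    linarith
  have hkdiff : ∀ x ∈ S, ∀ y ∈ S, ‖k x - k y‖ ≤ 2 * (α + C) * dist x y := by
    intro x hx y hy
    refine norm_le_of_forall_mem_Icc (by positivity) fun t ht => ?_
    simp only [hk, ContinuousMap.sub_apply]
    rw [add_sub_add_comm, add_sub_add_right_eq_sub, ← map_sub]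
    refine (norm_add_le _ _).trans ?_
    have h1 := (A t).le_of_opNorm_le_of_le (hα t ht) (hdiff x y (t : AddCircle T)).2
    have h2 := hNdiff x hx y hy t ht
    have h3 : C * ε * (2 * dist x y) ≤ C * 1 * (2 * dist x y) := by gcongr
    linarith
  have hΨdiff : ∀ x ∈ S, ∀ y ∈ S, dist (Ψ x) (Ψ y) ≤ δ * q * dist x y := by
    intro x hx y hy
    have hD := dist_nonneg (x := x) (y := y)
    rw [Prod.dist_eq]
    refine max_le ?_ ?_
    · simp only [Ψ]
      rw [dist_sub_left, dist_eq_norm, ← map_sub, ← intervalIntegral.integral_sub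
        ((continuous_comp_coe _).intervalIntegrable _ _)
        ((continuous_comp_coe _).intervalIntegrable _ _)]
      have h1 := norm_integral_coe_le (m x - m y) (right_mem_Icc.2 hT.le)
      simp only [ContinuousMap.sub_apply] at h1
      have h2 := (L.symm : E →L[ℝ] E).le_of_opNorm_le_of_le le_rfl h1
      refine h2.trans ?_
      have h3 : Λ * (T * ‖m x - m y‖) ≤ Λ * (T * (δ * (α + 2 * C) * dist x y)) := by
        gcongr; exact hmdiff x hx y hy
      refine h3.trans ?_
      have h4 : 0 ≤ δ * (2 * T * (2 * (α + C))) * dist x y := by positivity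
      rw [hq]; linarith
    · simp only [Ψ]
      rw [dist_eq_norm, ← smul_sub, ← periodicPrimitive_sub, norm_smul,
        Real.norm_of_nonneg hδ0.le]
      have h1 := norm_periodicPrimitive_le (k x - k y)
      have h2 : δ * ‖periodicPrimitive (k x - k y)‖ ≤
          δ * (2 * T * (2 * (α + C) * dist x y)) := by
        gcongr
        refine h1.trans ?_
        gcongr
        exact hkdiff x hx y hy
      refine h2.trans ?_
      have h4 : 0 ≤ δ * (Λ * (T * (α + 2 * C))) * dist x y := by positivity
      rw [hq]; linarith
  have hNz : ∀ t ∈ Icc 0 T, ‖N ε t z₀‖ ≤ C * ε * ‖z₀‖ := by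
    intro t ht
    have h := hlip ε hε hε1 t ht z₀ 0 (by rw [hR]; linarith) (by rw [norm_zero]; positivity)
    simpa [hN0] using h
  have hΨ₀ : dist (Ψ x₀) x₀ ≤ δ * d := by
    rw [Prod.dist_eq]
    refine max_le ?_ ?_
    · have hm₀ : ‖m x₀‖ ≤ δ * (C * ‖z₀‖) := by
        refine norm_le_of_forall_mem_Icc (by positivity) fun t ht => ?_
        simp only [hm, x₀, ContinuousMap.zero_apply, map_zero, smul_zero,
          add_zero, zero_add]
        have h3 : C * ε * ‖z₀‖ ≤ C * δ * ‖z₀‖ := by gcongr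
        linarith [hNz t ht]
      simp only [Ψ, x₀]
      rw [dist_eq_norm, sub_sub_cancel_left, norm_neg]
      have h1 := norm_integral_coe_le (m x₀) (right_mem_Icc.2 hT.le)
      refine ((L.symm : E →L[ℝ] E).le_of_opNorm_le_of_le le_rfl h1).trans ?_
      have h3 : Λ * (T * ‖m x₀‖) ≤ Λ * (T * (δ * (C * ‖z₀‖))) := by gcongr
      refine h3.trans ?_
      have h4 : 0 ≤ δ * (2 * T * (α * ‖z₀‖ + γ + C * ‖z₀‖)) := by positivity
      rw [hd]; linarith
    · have hk₀ : ‖k x₀‖ ≤ α * ‖z₀‖ + γ + C * ‖z₀‖ := by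
        refine norm_le_of_forall_mem_Icc (by positivity) fun t ht => ?_
        simp only [hk, x₀, ContinuousMap.zero_apply, smul_zero, add_zero]
        have h1 := (A t).le_of_opNorm_le_of_le (hα t ht) (le_refl ‖z₀‖)
        have h3 : C * ε * ‖z₀‖ ≤ C * 1 * ‖z₀‖ := by gcongr
        linarith [hNz t ht, hγ t ht, norm_add₃_le (a := A t z₀) (b := c t) (c := N ε t z₀)]
      simp only [Ψ, x₀]
      rw [dist_zero_right, norm_smul, Real.norm_of_nonneg hδ0.le]
      have h1 := norm_periodicPrimitive_le (k x₀)
      have h2 : δ * ‖periodicPrimitive (k x₀)‖ ≤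
          δ * (2 * T * (α * ‖z₀‖ + γ + C * ‖z₀‖)) := by
        gcongr
        refine h1.trans ?_
        gcongr
      refine h2.trans ?_
      have h4 : 0 ≤ δ * (Λ * (T * (C * ‖z₀‖))) := by positivity
      rw [hd]; linarith
  obtain ⟨x, hxS, hfix⟩ := exists_isFixedPt_closedBall (by positivity) zero_le_one (by nlinarith)
    (by linarith) hΨdiff hΨ₀
  have hfix1 : z₀ - L.symm (∫ t in (0 : ℝ)..T, m x (t : AddCircle T)) = x.1 :=
    congrArg Prod.fst hfix
  have hfix2 : δ • periodicPrimitive (k x) = x.2 := congrArg Prod.snd hfix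
  have hmean : ∫ t in (0 : ℝ)..T, k x (t : AddCircle T) = 0 := by
    have hAi : IntervalIntegrable (fun t => A t x.1) volume 0 T :=
      (hA.clm_apply continuous_const).intervalIntegrable _ _
    have h1 : ∫ t in (0 : ℝ)..T, k x (t : AddCircle T) =
        L x.1 + (∫ t in (0 : ℝ)..T, c t) + ∫ t in (0 : ℝ)..T, m x (t : AddCircle T) := by
      rw [← hL, ← intervalIntegral.integral_add hAi (hc.intervalIntegrable _ _),
        ← intervalIntegral.integral_add (hAi.add (hc.intervalIntegrable _ _))
          ((continuous_comp_coe _).intervalIntegrable _ _)]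
      refine integral_congr fun t _ => ?_
      simp only [hk, hm, map_add, map_smul]
      abel
    rw [h1, ← hfix1, map_sub, hz₀, map_neg, L.apply_symm_apply, L.apply_symm_apply]
    abel
  let w : ℝ → E := fun t => x.1 + δ • x.2 (t : AddCircle T)
  have hw : ∀ t, w t = x.1 + ε • ∫ s in (0 : ℝ)..t, k x (s : AddCircle T) := by
    intro t
    simp only [w]
    conv_lhs => rw [← hfix2]
    rw [ContinuousMap.smul_apply, periodicPrimitive_coe]
    rw [hmean, smul_zero, sub_zero, smul_smul, hδε]
  refine ⟨w, fun t => by simp [w], fun t => ?_, hbound x hxS _⟩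
  have hder : HasDerivAt (fun t => x.1 + ε • ∫ s in (0 : ℝ)..t, k x (s : AddCircle T))
      (ε • k x (t : AddCircle T)) t :=
    (((continuous_comp_coe (k x)).integral_hasStrictDerivAt 0 t).hasDerivAt.const_smul
      ε).const_add _
  rw [← funext hw, hk] at hder
  exact hder

end Averaging

/-! ### Taylor estimates at the equilibrium -/

section Taylor

variable {F : ℝ → ℝ → ℝ → ℝ}

lemma IsSmooth.continuous (hF : IsSmooth F) : Continuous fun x : ℝ × ℝ × ℝ => F x.1 x.2.1 x.2.2 :=
  ContDiff.continuous hF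

/-- The total derivative at `(t, 0, 0)` in terms of the partial derivatives `f₁` and `f₂`. -/
lemma IsSmooth.fderiv_apply (hF : IsSmooth F) (t x y : ℝ) :
    fderiv ℝ (fun x : ℝ × ℝ × ℝ => F x.1 x.2.1 x.2.2) (t, 0, 0) (0, x, y) =
      f₁ F t * x + f₂ F t * y := by
  have hd : HasFDerivAt (fun x : ℝ × ℝ × ℝ => F x.1 x.2.1 x.2.2)
      (fderiv ℝ (fun x : ℝ × ℝ × ℝ => F x.1 x.2.1 x.2.2) (t, 0, 0)) (t, 0, 0) :=
    (ContDiff.differentiable hF (by simp)).differentiableAt.hasFDerivAt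
  set D := fderiv ℝ (fun x : ℝ × ℝ × ℝ => F x.1 x.2.1 x.2.2) (t, 0, 0)
  have h1 : HasDerivAt (fun q : ℝ => ((t, q, 0) : ℝ × ℝ × ℝ)) (0, 1, 0) 0 :=
    (hasDerivAt_const _ _).prodMk ((hasDerivAt_id _).prodMk (hasDerivAt_const _ _))
  have h2 : HasDerivAt (fun q : ℝ => ((t, 0, q) : ℝ × ℝ × ℝ)) (0, 0, 1) 0 :=
    (hasDerivAt_const _ _).prodMk ((hasDerivAt_const _ _).prodMk (hasDerivAt_id _))
  have e1 : f₁ F t = D (0, 1, 0) := (hd.comp_hasDerivAt_of_eq 0 h1 rfl).deriv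
  have e2 : f₂ F t = D (0, 0, 1) := (hd.comp_hasDerivAt_of_eq 0 h2 rfl).deriv
  have e3 : ((0, x, y) : ℝ × ℝ × ℝ) = x • (0, 1, 0) + y • (0, 0, 1) := by simp
  rw [e1, e2, e3, map_add, map_smul, map_smul, smul_eq_mul, smul_eq_mul]
  ring

lemma IsSmooth.continuous_f₁ (hF : IsSmooth F) : Continuous (f₁ F) := by
  have h : f₁ F = fun t =>
      fderiv ℝ (fun x : ℝ × ℝ × ℝ => F x.1 x.2.1 x.2.2) (t, 0, 0) (0, 1, 0) := by
    ext t; simp [hF.fderiv_apply]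
  rw [h]
  exact ((ContDiff.continuous_fderiv hF (by simp)).comp (by fun_prop)).clm_apply continuous_const

lemma IsSmooth.continuous_f₂ (hF : IsSmooth F) : Continuous (f₂ F) := by
  have h : f₂ F = fun t =>
      fderiv ℝ (fun x : ℝ × ℝ × ℝ => F x.1 x.2.1 x.2.2) (t, 0, 0) (0, 0, 1) := by
    ext t; simp [hF.fderiv_apply]
  rw [h]
  exact ((ContDiff.continuous_fderiv hF (by simp)).comp (by fun_prop)).clm_apply continuous_const

lemma IsSmooth.exists_lipschitz (hF : IsSmooth F) (T r : ℝ) :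
    ∃ C : ℝ, 0 ≤ C ∧ ∀ t ∈ Icc 0 T, ∀ u w : ℝ × ℝ, ‖u‖ ≤ r → ‖w‖ ≤ r →
      |F t u.1 u.2 - F t w.1 w.2| ≤ C * ‖u - w‖ := by
  have hK : IsCompact (Icc 0 T ×ˢ Metric.closedBall (0 : ℝ × ℝ) r) :=
    isCompact_Icc.prod (isCompact_closedBall _ _)
  obtain ⟨C, hC⟩ := (ContDiff.locallyLipschitz (ContDiff.of_le hF (by simp))).locallyLipschitzOn
    |>.exists_lipschitzOnWith_of_compact hK
  refine ⟨C, C.2, fun t ht u w hu hw => ?_⟩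
  have h := hC.dist_le_mul (t, u) ⟨ht, by simpa using hu⟩ (t, w) ⟨ht, by simpa using hw⟩
  simpa [Prod.dist_eq, dist_eq_norm, Prod.norm_def] using h

/-- The remainder of the linearisation at `(t, 0, 0)` is `Cρ`-Lipschitz on the ball of radius `ρ`,
uniformly for `t` in a compact interval, since the derivative is locally Lipschitz. -/
lemma IsSmooth.exists_lipschitz_remainder (hF : IsSmooth F) (T r : ℝ) :
    ∃ C : ℝ, 0 ≤ C ∧ ∀ ρ, 0 ≤ ρ → ρ ≤ r → ∀ t ∈ Icc 0 T, ∀ u w : ℝ × ℝ, ‖u‖ ≤ ρ → ‖w‖ ≤ ρ →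
      |F t u.1 u.2 - F t w.1 w.2 - (f₁ F t * (u.1 - w.1) + f₂ F t * (u.2 - w.2))| ≤
        C * ρ * ‖u - w‖ := by
  have hK : IsCompact (Icc 0 T ×ˢ Metric.closedBall (0 : ℝ × ℝ) r) :=
    isCompact_Icc.prod (isCompact_closedBall _ _)
  obtain ⟨C, hC⟩ := (ContDiff.locallyLipschitz
    (ContDiff.fderiv_right (m := 1) hF (WithTop.coe_le_coe.2 le_top))).locallyLipschitzOn
    |>.exists_lipschitzOnWith_of_compact hK
  refine ⟨C, C.2, fun ρ hρ hρr t ht u w hu hw => ?_⟩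
  have hconv : Convex ℝ ({t} ×ˢ Metric.closedBall (0 : ℝ × ℝ) ρ) :=
    (convex_singleton t).prod (convex_closedBall _ _)
  have h := hconv.norm_image_sub_le_of_norm_fderiv_le' (𝕜 := ℝ)
    (f := fun x : ℝ × ℝ × ℝ => F x.1 x.2.1 x.2.2) (C := C * ρ)
    (φ := fderiv ℝ (fun x : ℝ × ℝ × ℝ => F x.1 x.2.1 x.2.2) (t, 0, 0))
    (fun x _ => (ContDiff.differentiable hF (by simp)).differentiableAt) ?_
    (x := (t, w)) (y := (t, u)) ⟨rfl, by simpa using hw⟩ ⟨rfl, by simpa using hu⟩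
  · have e : ((t, u) : ℝ × ℝ × ℝ) - (t, w) = (0, u.1 - w.1, u.2 - w.2) := by
      ext <;> simp
    rw [e, hF.fderiv_apply] at h
    simpa [Prod.norm_def] using h
  · rintro ⟨s, z⟩ ⟨hs, hz⟩
    obtain rfl : s = t := hs
    have hz' : ‖z‖ ≤ ρ := by simpa using hz
    have h := hC.dist_le_mul (s, z) ⟨ht, by simpa using hz'.trans hρr⟩ (s, 0)
      ⟨ht, by simpa using hρ.trans hρr⟩
    rw [dist_eq_norm] at h
    refine h.trans (mul_le_mul_of_nonneg_left ?_ C.2)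
    simpa [Prod.dist_eq] using hz'

lemma abs_sin_sub_self_sub_le {ρ u w : ℝ} (hu : |u| ≤ ρ) (hw : |w| ≤ ρ) :
    |(Real.sin u - u) - (Real.sin w - w)| ≤ ρ ^ 2 * |u - w| := by
  have h := (convex_Icc (-ρ) ρ).norm_image_sub_le_of_norm_hasDerivWithin_le
    (f := fun x => Real.sin x - x) (f' := fun x => Real.cos x - 1) (C := ρ ^ 2)
    (fun x _ => ((Real.hasDerivAt_sin x).sub (hasDerivAt_id x)).hasDerivWithinAt) ?_
    (abs_le.1 hw) (abs_le.1 hu)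
  · exact h
  · intro x hx
    have h1 := Real.one_sub_sq_div_two_le_cos (x := x)
    have h2 := Real.cos_le_one x
    have h3 : x ^ 2 ≤ ρ ^ 2 := sq_le_sq' hx.1 hx.2
    rw [Real.norm_eq_abs, abs_le]
    constructor <;> nlinarith [sq_nonneg x]

end Taylor

/-! ### The pendulum in the variables of the linear oscillator -/

section Pendulum

/-- The angle at time `t` of the solution of `x'' = -a x` with `(x(0), x'(0)) = w`. -/
noncomputable def freeAngle (a t : ℝ) (w : Fin 2 → ℝ) : ℝ :=
  Real.cos (√a * t) * w 0 + Real.sin (√a * t) / √a * w 1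

/-- The velocity at time `t` of the solution of `x'' = -a x` with `(x(0), x'(0)) = w`. -/
noncomputable def freeVelocity (a t : ℝ) (w : Fin 2 → ℝ) : ℝ :=
  -(√a * Real.sin (√a * t)) * w 0 + Real.cos (√a * t) * w 1

/-- The unit force `(0, 1)` acting at time `t`, pulled back to time `0` by the flow of
`x'' = -a x`. -/
noncomputable def pulledForce (a t : ℝ) : Fin 2 → ℝ :=
  ![-(Real.sin (√a * t) / √a), Real.cos (√a * t)]

/-- The linear part `f₁ x + (f₂ - b̄) x'` of the perturbing force, as a functional of the initial
conditions of the free motion `x`. -/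
noncomputable def linearForce (a bbar : ℝ) (f : ℝ → ℝ → ℝ → ℝ) (t : ℝ) : (Fin 2 → ℝ) →L[ℝ] ℝ :=
  (f₁ f t * Real.cos (√a * t) - (f₂ f t - bbar) * (√a * Real.sin (√a * t))) •
      ContinuousLinearMap.proj 0 +
    (f₁ f t * (Real.sin (√a * t) / √a) + (f₂ f t - bbar) * Real.cos (√a * t)) •
      ContinuousLinearMap.proj 1

/-- What is left of the perturbing force, divided by `ε²` after the substitution `θ = ε x`, when its
linear part and `g₀` are removed. It includes the nonlinear part of `-a sin θ`; the arguments `x`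
and `y` stand for `x` and `x'`. The (junk) value at `ε = 0` plays no role. -/
noncomputable def forceRemainder (a : ℝ) (f g : ℝ → ℝ → ℝ → ℝ) (ε t x y : ℝ) : ℝ :=
  -a * (Real.sin (ε * x) - ε * x) / ε ^ 2 +
    (f t (ε * x) (ε * y) - (f₁ f t * (ε * x) + f₂ f t * (ε * y))) / ε +
    (g t (ε * x) (ε * y) - g₀ g t)

variable {a bbar : ℝ} {p : ℕ} {f g : ℝ → ℝ → ℝ → ℝ}

lemma linearForce_apply (t : ℝ) (w : Fin 2 → ℝ) : linearForce a bbar f t w =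
    f₁ f t * freeAngle a t w + (f₂ f t - bbar) * freeVelocity a t w := by
  simp [linearForce, freeAngle, freeVelocity]
  ring

lemma sqrt_mul_period (ha : 0 < a) : √a * period a p = p * (2 * Real.pi) := by
  have := Real.sqrt_pos.2 ha
  rw [period]
  field_simp

lemma cos_sqrt_mul_add_period (ha : 0 < a) (t : ℝ) :
    Real.cos (√a * (t + period a p)) = Real.cos (√a * t) := by
  rw [mul_add, sqrt_mul_period ha, Real.cos_add_nat_mul_two_pi]

lemma sin_sqrt_mul_add_period (ha : 0 < a) (t : ℝ) :
    Real.sin (√a * (t + period a p)) = Real.sin (√a * t) := by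
  rw [mul_add, sqrt_mul_period ha, Real.sin_add_nat_mul_two_pi]

lemma sin_sqrt_mul_period (ha : 0 < a) : Real.sin (√a * period a p) = 0 := by
  simpa using sin_sqrt_mul_add_period (p := p) ha 0

lemma integral_sin_sq_sqrt_mul (ha : 0 < a) :
    ∫ t in (0 : ℝ)..period a p, Real.sin (√a * t) ^ 2 = p * Real.pi / √a := by
  have h := Real.sqrt_pos.2 ha
  rw [intervalIntegral.integral_comp_mul_left (fun x => Real.sin x ^ 2) h.ne', integral_sin_sq,
    sin_sqrt_mul_period ha, sqrt_mul_period ha]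
  simp
  field_simp

lemma integral_cos_sq_sqrt_mul (ha : 0 < a) :
    ∫ t in (0 : ℝ)..period a p, Real.cos (√a * t) ^ 2 = p * Real.pi / √a := by
  have h := Real.sqrt_pos.2 ha
  rw [intervalIntegral.integral_comp_mul_left (fun x => Real.cos x ^ 2) h.ne', integral_cos_sq,
    sin_sqrt_mul_period ha, sqrt_mul_period ha]
  simp
  field_simp

lemma integral_sin_mul_cos_sqrt_mul (ha : 0 < a) :
    ∫ t in (0 : ℝ)..period a p, Real.sin (√a * t) * Real.cos (√a * t) = 0 := by
  have h := Real.sqrt_pos.2 ha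
  rw [intervalIntegral.integral_comp_mul_left (fun x => Real.sin x * Real.cos x) h.ne',
    integral_sin_mul_cos₁, sin_sqrt_mul_period ha]
  simp

lemma continuous_pulledForce : Continuous (pulledForce a) := by
  refine continuous_pi fun i => ?_
  fin_cases i <;> simp [pulledForce] <;> fun_prop

lemma continuous_linearForce (hf : IsSmooth f) : Continuous (linearForce a bbar f) := by
  have h1 := hf.continuous_f₁
  have h2 := hf.continuous_f₂
  unfold linearForce
  fun_prop

/-- The mean of the pulled back linear force is the matrix `M`; the damping enters through the mean
of `sin²` and `cos²`. -/
lemma integral_linearForce_smul_pulledForce (ha : 0 < a) (hf : IsSmooth f) (z : Fin 2 → ℝ) :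
    ∫ t in (0 : ℝ)..period a p, linearForce a bbar f t z • pulledForce a t =
      (M a bbar p f).mulVec z := by
  have hs := Real.sqrt_pos.2 ha
  have hsa : √a * √a = a := Real.mul_self_sqrt ha.le
  have h1 := hf.continuous_f₁
  have h2 := hf.continuous_f₂
  have hi : IntervalIntegrable (fun t => linearForce a bbar f t z • pulledForce a t) volume 0
      (period a p) :=
    (((continuous_linearForce hf).clm_apply continuous_const).smul
      continuous_pulledForce).intervalIntegrable _ _
  ext i
  rw [← ContinuousLinearMap.proj_apply (R := ℝ) (φ := fun _ => ℝ) i (∫ t in (0 : ℝ)..period a p, _),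
    ← ContinuousLinearMap.intervalIntegral_comp_comm _ hi]
  have hI1 := integral_sin_sq_sqrt_mul (p := p) ha
  have hI2 := integral_cos_sq_sqrt_mul (p := p) ha
  have hI3 := integral_sin_mul_cos_sqrt_mul (p := p) ha
  fin_cases i
  · change ∫ t in (0 : ℝ)..period a p, linearForce a bbar f t z * pulledForce a t 0 =
      ∑ j, M a bbar p f 0 j * z j
    simp only [Fin.sum_univ_two, M, Matrix.of_apply, Matrix.cons_val_zero, Matrix.cons_val_one]
    have e : ∀ t, linearForce a bbar f t z * pulledForce a t 0 =
        Real.sin (√a * t) * (-(Real.cos (√a * t) / √a) * f₁ f t + Real.sin (√a * t) * f₂ f t)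
          * z 0 + Real.sin (√a * t) / a *
          (-(Real.sin (√a * t)) * f₁ f t - √a * Real.cos (√a * t) * f₂ f t) * z 1
          - bbar * z 0 * Real.sin (√a * t) ^ 2
          + bbar * z 1 / √a * (Real.sin (√a * t) * Real.cos (√a * t)) := by
      intro t
      rw [linearForce_apply,
        show Real.sin (√a * t) / a = Real.sin (√a * t) / (√a * √a) by rw [hsa]]
      simp only [freeAngle, freeVelocity, pulledForce, Matrix.cons_val_zero]
      field_simp
      ring
    rw [integral_congr fun t _ => e t, intervalIntegral.integral_add,
      intervalIntegral.integral_sub, intervalIntegral.integral_add,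
      intervalIntegral.integral_mul_const, intervalIntegral.integral_mul_const,
      intervalIntegral.integral_const_mul, intervalIntegral.integral_const_mul, hI1, hI3]
    · ring
    all_goals exact Continuous.intervalIntegrable (by fun_prop) _ _
  · change ∫ t in (0 : ℝ)..period a p, linearForce a bbar f t z * pulledForce a t 1 =
      ∑ j, M a bbar p f 1 j * z j
    simp only [Fin.sum_univ_two, M, Matrix.of_apply, Matrix.cons_val_zero, Matrix.cons_val_one]
    have e : ∀ t, linearForce a bbar f t z * pulledForce a t 1 =
        Real.cos (√a * t) * (Real.cos (√a * t) * f₁ f t - √a * Real.sin (√a * t) * f₂ f t)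
          * z 0 + Real.cos (√a * t) *
          (Real.sin (√a * t) / √a * f₁ f t + Real.cos (√a * t) * f₂ f t) * z 1
          - bbar * z 1 * Real.cos (√a * t) ^ 2
          + bbar * z 0 * √a * (Real.sin (√a * t) * Real.cos (√a * t)) := by
      intro t
      rw [linearForce_apply]
      simp only [freeAngle, freeVelocity, pulledForce, Matrix.cons_val_one, Matrix.cons_val_zero]
      ring
    rw [integral_congr fun t _ => e t, intervalIntegral.integral_add,
      intervalIntegral.integral_sub, intervalIntegral.integral_add,
      intervalIntegral.integral_mul_const, intervalIntegral.integral_mul_const,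
      intervalIntegral.integral_const_mul, intervalIntegral.integral_const_mul, hI2, hI3]
    · ring
    all_goals exact Continuous.intervalIntegrable (by fun_prop) _ _

/-- Free motions and the pulled back unit force are bounded uniformly in time. -/
lemma exists_norm_free_le (a : ℝ) : ∃ κ : ℝ, 0 ≤ κ ∧ ∀ t, ‖pulledForce a t‖ ≤ κ ∧
    ∀ w, |freeAngle a t w| ≤ κ * ‖w‖ ∧ |freeVelocity a t w| ≤ κ * ‖w‖ := by
  have hs := Real.sqrt_nonneg a
  have hsi : 0 ≤ (√a)⁻¹ := inv_nonneg.2 hs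
  have hsin : ∀ t, |Real.sin (√a * t) / √a| ≤ (√a)⁻¹ := fun t => by
    rw [abs_div, abs_of_nonneg hs, div_eq_mul_inv]
    exact mul_le_of_le_one_left hsi (Real.abs_sin_le_one _)
  have hsin' : ∀ t, |√a * Real.sin (√a * t)| ≤ √a := fun t => by
    rw [abs_mul, abs_of_nonneg hs]
    exact mul_le_of_le_one_right hs (Real.abs_sin_le_one _)
  refine ⟨1 + √a + (√a)⁻¹, by positivity, fun t => ⟨?_, fun w => ?_⟩⟩
  · refine (pi_norm_le_iff_of_nonneg (by positivity)).2 fun i => ?_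
    have h1 := hsin t
    have h2 := Real.abs_cos_le_one (√a * t)
    fin_cases i
    · simp only [pulledForce, Fin.zero_eta, Matrix.cons_val_zero, norm_neg, Real.norm_eq_abs]
      linarith
    · simp only [pulledForce, Fin.mk_one, Matrix.cons_val_one, Matrix.cons_val_zero,
        Real.norm_eq_abs]
      linarith
  · have h0 : |w 0| ≤ ‖w‖ := norm_le_pi_norm w 0
    have h1 : |w 1| ≤ ‖w‖ := norm_le_pi_norm w 1
    have hw := norm_nonneg w
    have hcos := Real.abs_cos_le_one (√a * t)
    have key : ∀ u v s r : ℝ, |u| ≤ s → |v| ≤ r → |u * w 0 + v * w 1| ≤ (s + r) * ‖w‖ := by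
      intro u v s r hu hv
      refine (abs_add_le _ _).trans ?_
      rw [abs_mul, abs_mul, add_mul]
      exact add_le_add (mul_le_mul hu h0 (abs_nonneg _) ((abs_nonneg _).trans hu))
        (mul_le_mul hv h1 (abs_nonneg _) ((abs_nonneg _).trans hv))
    constructor
    · refine (key _ _ _ _ hcos (hsin t)).trans (mul_le_mul_of_nonneg_right (by linarith) hw)
    · refine (key _ _ _ _ ((abs_neg _).trans_le (hsin' t)) hcos).trans
        (mul_le_mul_of_nonneg_right (by linarith) hw)

lemma freeAngle_sub (t : ℝ) (u w : Fin 2 → ℝ) :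
    freeAngle a t (u - w) = freeAngle a t u - freeAngle a t w := by
  simp [freeAngle]; ring

lemma freeVelocity_sub (t : ℝ) (u w : Fin 2 → ℝ) :
    freeVelocity a t (u - w) = freeVelocity a t u - freeVelocity a t w := by
  simp [freeVelocity]; ring

/-- The remainder is `O(ε)`-Lipschitz on bounded sets: rescaled to a ball of radius `ε r`, the three
summands have Lipschitz constants of order `ε² · ε / ε²`, `ε · ε / ε` and `ε`. -/
lemma exists_forceRemainder_lipschitz (ha : 0 < a) (hf : IsSmooth f) (hg : IsSmooth g) (T : ℝ)
    {r : ℝ} (hr : 0 ≤ r) :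
    ∃ C : ℝ, 0 ≤ C ∧ ∀ ε, 0 < ε → ε ≤ 1 → ∀ t ∈ Icc 0 T, ∀ u w : ℝ × ℝ, ‖u‖ ≤ r → ‖w‖ ≤ r →
      |forceRemainder a f g ε t u.1 u.2 - forceRemainder a f g ε t w.1 w.2| ≤
        C * ε * ‖u - w‖ := by
  obtain ⟨Cf, hCf, hf'⟩ := hf.exists_lipschitz_remainder T r
  obtain ⟨Cg, hCg, hg'⟩ := hg.exists_lipschitz T r
  refine ⟨a * r ^ 2 + Cf * r + Cg, by positivity, fun ε hε hε1 t ht u w hu hw => ?_⟩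
  have hεu : ∀ {u : ℝ × ℝ}, ‖u‖ ≤ r → ‖ε • u‖ ≤ ε * r := fun h => by
    rw [norm_smul, Real.norm_of_nonneg hε.le]; exact mul_le_mul_of_nonneg_left h hε.le
  have hεr : ε * r ≤ r := mul_le_of_le_one_left hr hε1
  have hsub : ‖ε • u - ε • w‖ = ε * ‖u - w‖ := by
    rw [← smul_sub, norm_smul, Real.norm_of_nonneg hε.le]
  have h1 := abs_sin_sub_self_sub_le ((norm_fst_le (ε • u)).trans (hεu hu))
    ((norm_fst_le (ε • w)).trans (hεu hw))
  have h1' : |(ε • u).1 - (ε • w).1| ≤ ε * ‖u - w‖ := hsub ▸ norm_fst_le (ε • u - ε • w)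
  have h2 := hf' (ε * r) (by positivity) hεr t ht _ _ (hεu hu) (hεu hw)
  have h3 := hg' t ht _ _ ((hεu hu).trans hεr) ((hεu hw).trans hεr)
  rw [hsub] at h2 h3
  simp only [Prod.smul_fst, Prod.smul_snd, smul_eq_mul] at h1 h1' h2 h3
  have e : forceRemainder a f g ε t u.1 u.2 - forceRemainder a f g ε t w.1 w.2 =
      -(a / ε ^ 2) * ((Real.sin (ε * u.1) - ε * u.1) - (Real.sin (ε * w.1) - ε * w.1)) +
      1 / ε * (f t (ε * u.1) (ε * u.2) - f t (ε * w.1) (ε * w.2) -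
        (f₁ f t * (ε * u.1 - ε * w.1) + f₂ f t * (ε * u.2 - ε * w.2))) +
      (g t (ε * u.1) (ε * u.2) - g t (ε * w.1) (ε * w.2)) := by
    simp only [forceRemainder]
    ring
  rw [e]
  refine (abs_add_three _ _ _).trans ?_
  rw [abs_mul, abs_mul, abs_neg, abs_of_nonneg (by positivity : 0 ≤ a / ε ^ 2),
    abs_of_nonneg (by positivity : 0 ≤ 1 / ε)]
  have k1 := mul_le_mul_of_nonneg_left (h1.trans (mul_le_mul_of_nonneg_left h1' (by positivity)))
    (by positivity : 0 ≤ a / ε ^ 2)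
  have k2 := mul_le_mul_of_nonneg_left h2 (by positivity : 0 ≤ 1 / ε)
  have k1' : a / ε ^ 2 * ((ε * r) ^ 2 * (ε * ‖u - w‖)) = a * r ^ 2 * ε * ‖u - w‖ := by
    field_simp
  have k2' : 1 / ε * (Cf * (ε * r) * (ε * ‖u - w‖)) = Cf * r * ε * ‖u - w‖ := by
    field_simp
  linarith

/-- Variation of constants: if the initial conditions `w` move along the pulled back force with
strength `h`, then the resulting motion solves `x'' = -a x + h`. -/
lemma hasDerivAt_freeAngle_and_freeVelocity {w : ℝ → Fin 2 → ℝ} {h t : ℝ}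
    (hw : HasDerivAt w (h • pulledForce a t) t) (ha : 0 < a) :
    HasDerivAt (fun t => freeAngle a t (w t)) (freeVelocity a t (w t)) t ∧
    HasDerivAt (fun t => freeVelocity a t (w t)) (-a * freeAngle a t (w t) + h) t := by
  have hs := Real.sqrt_pos.2 ha
  have hsa : √a * √a = a := Real.mul_self_sqrt ha.le
  have h0 := hasDerivAt_pi.1 hw 0
  have h1 := hasDerivAt_pi.1 hw 1
  simp only [Pi.smul_apply, pulledForce, Matrix.cons_val_zero, Matrix.cons_val_one,
    smul_eq_mul] at h0 h1
  have hl : HasDerivAt (fun t => √a * t) √a t := by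
    simpa using (hasDerivAt_id t).const_mul √a
  have hc := hl.cos
  have hsn := hl.sin
  have htrig := Real.sin_sq_add_cos_sq (√a * t)
  constructor
  · refine ((hc.mul h0).add ((hsn.div_const √a).mul h1)).congr_deriv ?_
    simp only [freeVelocity]
    field_simp
    ring
  · have hn : HasDerivAt (fun t => -(√a * Real.sin (√a * t)))
        (-(√a * (Real.cos (√a * t) * √a))) t := (hsn.const_mul √a).neg
    refine ((hn.mul h0).add (hc.mul h1)).congr_deriv ?_
    have e : -a * freeAngle a t (w t) = -(√a * √a) * freeAngle a t (w t) := by rw [hsa]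
    rw [e]
    simp only [freeAngle]
    field_simp
    linear_combination h * htrig

end Pendulum

end PerturbedPendulum

/-! ### Existence of periodic solutions -/

open PerturbedPendulum

theorem theorem1 (a bbar : ℝ) (ha : 0 < a) (hb : 0 < bbar) (p : ℕ) (hp : 0 < p)
    (f g : ℝ → ℝ → ℝ → ℝ)
    (hf : PerturbedPendulum.IsSmooth f) (hg : PerturbedPendulum.IsSmooth g)
    (hfT : ∀ t q w : ℝ, f (t + PerturbedPendulum.period a p) q w = f t q w)
    (hgT : ∀ t q w : ℝ, g (t + PerturbedPendulum.period a p) q w = g t q w)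
    (hf0 : ∀ t : ℝ, f t 0 0 = 0)
    (hM : (PerturbedPendulum.M a bbar p f).det ≠ 0)
    (hv : PerturbedPendulum.v a p g ≠ 0) :
    ∃ ε₀ : ℝ, 0 < ε₀ ∧ ∃ θ : ℝ → ℝ → ℝ,
      (∀ ε : ℝ, 0 < ε → ε < ε₀ →
        PerturbedPendulum.IsSolution a (ε * bbar) ε f g (θ ε) ∧
          Function.Periodic (θ ε) (PerturbedPendulum.period a p)) ∧
      Filter.Tendsto (fun ε => (θ ε 0, deriv (θ ε) 0)) (𝓝[>] (0 : ℝ)) (𝓝 ((0 : ℝ), (0 : ℝ))) := by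
  have hs := Real.sqrt_pos.2 ha
  have hT : 0 < period a p := by
    have : (0 : ℝ) < p := Nat.cast_pos.2 hp
    unfold period; positivity
  have hf₁T : ∀ t, f₁ f (t + period a p) = f₁ f t := fun t => by simp [f₁, hfT]
  have hf₂T : ∀ t, f₂ f (t + period a p) = f₂ f t := fun t => by simp [f₂, hfT]
  have hg₀T : ∀ t, g₀ g (t + period a p) = g₀ g t := fun t => by simp [g₀, hgT]
  have hqT : ∀ t, pulledForce a (t + period a p) = pulledForce a t := fun t => by
    simp only [pulledForce, cos_sqrt_mul_add_period ha, sin_sqrt_mul_add_period ha]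
  have hangT : ∀ t, freeAngle a (t + period a p) = freeAngle a t := fun t => by
    ext w; simp only [freeAngle, cos_sqrt_mul_add_period ha, sin_sqrt_mul_add_period ha]
  have hvelT : ∀ t, freeVelocity a (t + period a p) = freeVelocity a t := fun t => by
    ext w; simp only [freeVelocity, cos_sqrt_mul_add_period ha, sin_sqrt_mul_add_period ha]
  obtain ⟨κ, hκ, hfree⟩ := exists_norm_free_le a
  have hinv := Matrix.invertibleOfIsUnitDet _ (isUnit_iff_ne_zero.2 hM)
  let L : (Fin 2 → ℝ) ≃L[ℝ] (Fin 2 → ℝ) :=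
    ((M a bbar p f).toLinearEquiv' hinv).toContinuousLinearEquiv
  have havg := exists_periodic_of_averaged_equation hT
    (A := fun t => (linearForce a bbar f t).smulRight (pulledForce a t))
    (c := fun t => g₀ g t • pulledForce a t)
    (N := fun ε t w =>
      forceRemainder a f g ε t (freeAngle a t w) (freeVelocity a t w) • pulledForce a t)
    ?_ ?_ ?_ ?_ ?_ ?_ ?_ ?_ L ?_
  · obtain ⟨R, ε₀, hε₀, hsol⟩ := havg
    choose! W hWT hW hW0 using hsol
    -- Undo both changes of variables: `θ = ε x`, where `x` is the free motion from `W ε t`.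
    have hder : ∀ ε, 0 < ε → ε < ε₀ → ∀ t,
        HasDerivAt (fun t => ε * freeAngle a t (W ε t)) (ε * freeVelocity a t (W ε t)) t ∧
        HasDerivAt (fun t => ε * freeVelocity a t (W ε t))
          (-a * Real.sin (ε * freeAngle a t (W ε t)) -
            ε * bbar * (ε * freeVelocity a t (W ε t)) +
            ε * f t (ε * freeAngle a t (W ε t)) (ε * freeVelocity a t (W ε t)) +
            ε ^ 2 * g t (ε * freeAngle a t (W ε t)) (ε * freeVelocity a t (W ε t))) t := by
      intro ε hε hlt t
      have h := hW ε hε hlt t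
      simp only [ContinuousLinearMap.smulRight_apply, ← add_smul, smul_smul] at h
      obtain ⟨h1, h2⟩ := hasDerivAt_freeAngle_and_freeVelocity h ha
      refine ⟨h1.const_mul ε, (h2.const_mul ε).congr_deriv ?_⟩
      rw [linearForce_apply, forceRemainder]
      field_simp
      ring
    have hderiv : ∀ ε, 0 < ε → ε < ε₀ →
        deriv (fun t => ε * freeAngle a t (W ε t)) = fun t => ε * freeVelocity a t (W ε t) :=
      fun ε hε hlt => funext fun t => (hder ε hε hlt t).1.deriv
    refine ⟨ε₀, hε₀, fun ε t => ε * freeAngle a t (W ε t), fun ε hε hlt => ⟨⟨fun t =>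
      (hder ε hε hlt t).1.differentiableAt, fun t => ?_⟩, fun t => ?_⟩, ?_⟩
    · rw [hderiv ε hε hlt]
      exact (hder ε hε hlt t).2
    · simp only [hangT, hWT ε hε hlt t]
    · have hev : ∀ᶠ ε in 𝓝[>] (0 : ℝ), 0 < ε ∧ ε < ε₀ := Ioo_mem_nhdsGT hε₀
      have hlim : Filter.Tendsto (fun ε : ℝ => ε * (κ * R)) (𝓝[>] 0) (𝓝 0) :=
        Filter.Tendsto.mono_left (by simpa using (continuous_id.mul_const (κ * R)).tendsto 0)
          nhdsWithin_le_nhds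
      refine Filter.Tendsto.prodMk_nhds (squeeze_zero_norm' ?_ hlim) (squeeze_zero_norm' ?_ hlim)
      · filter_upwards [hev] with ε hε
        rw [norm_mul, Real.norm_of_nonneg hε.1.le]
        have := ((hfree 0).2 (W ε 0)).1
        exact mul_le_mul_of_nonneg_left (this.trans
          (mul_le_mul_of_nonneg_left (hW0 ε hε.1 hε.2) hκ)) hε.1.le
      · filter_upwards [hev] with ε hε
        rw [hderiv ε hε.1 hε.2, norm_mul, Real.norm_of_nonneg hε.1.le]
        have := ((hfree 0).2 (W ε 0)).2
        exact mul_le_mul_of_nonneg_left (this.trans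
          (mul_le_mul_of_nonneg_left (hW0 ε hε.1 hε.2) hκ)) hε.1.le
  · have h1 := continuous_linearForce (a := a) (bbar := bbar) hf
    have h2 := continuous_pulledForce (a := a)
    exact (ContinuousLinearMap.smulRightL ℝ (Fin 2 → ℝ) (Fin 2 → ℝ)).continuous₂.comp
      (h1.prodMk h2)
  · have h : Continuous (g₀ g) := hg.continuous.comp (f := fun t : ℝ => (t, (0 : ℝ), (0 : ℝ)))
      (by fun_prop)
    exact h.smul continuous_pulledForce
  · intro ε
    have h1 := hf.continuous_f₁
    have h2 := hf.continuous_f₂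
    have hc1 : Continuous fun x : ℝ × (Fin 2 → ℝ) => freeAngle a x.1 x.2 := by
      unfold freeAngle; fun_prop
    have hc2 : Continuous fun x : ℝ × (Fin 2 → ℝ) => freeVelocity a x.1 x.2 := by
      unfold freeVelocity; fun_prop
    have hF : ∀ F : ℝ → ℝ → ℝ → ℝ, IsSmooth F → Continuous fun x : ℝ × (Fin 2 → ℝ) =>
        F x.1 (ε * freeAngle a x.1 x.2) (ε * freeVelocity a x.1 x.2) := fun F hF =>
      hF.continuous.comp (f := fun x : ℝ × (Fin 2 → ℝ) =>
        (x.1, ε * freeAngle a x.1 x.2, ε * freeVelocity a x.1 x.2)) (by fun_prop)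
    have h3 := hF f hf
    have h4 := hF g hg
    have h5 : Continuous (g₀ g) := hg.continuous.comp (f := fun t : ℝ => (t, (0 : ℝ), (0 : ℝ)))
      (by fun_prop)
    have h6 := continuous_pulledForce (a := a)
    have h7 : Continuous fun x : ℝ × (Fin 2 → ℝ) =>
        -a * (Real.sin (ε * freeAngle a x.1 x.2) - ε * freeAngle a x.1 x.2) / ε ^ 2 := by fun_prop
    have h8 : Continuous fun x : ℝ × (Fin 2 → ℝ) =>
        f₁ f x.1 * (ε * freeAngle a x.1 x.2) + f₂ f x.1 * (ε * freeVelocity a x.1 x.2) := by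
      fun_prop
    exact ((h7.add ((h3.sub h8).div_const ε)).add (h4.sub (h5.comp continuous_fst))).smul
      (h6.comp continuous_fst)
  · intro t
    have : linearForce a bbar f (t + period a p) = linearForce a bbar f t := by
      ext1 w
      simp only [linearForce_apply, hf₁T, hf₂T, hangT, hvelT]
    simp only [this, hqT]
  · intro t
    simp only [hg₀T, hqT]
  · intro ε t
    simp only [forceRemainder, hfT, hgT, hf₁T, hf₂T, hg₀T, hangT, hvelT, hqT]
  · intro ε t
    simp [forceRemainder, freeAngle, freeVelocity, hf0, g₀]
  · intro R hR
    obtain ⟨C, hC, hlip⟩ := exists_forceRemainder_lipschitz (g := g) ha hf hg (period a p)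
      (mul_nonneg hκ hR)
    refine ⟨C * κ * κ, by positivity, fun ε hε hε1 t ht x y hx hy => ?_⟩
    have hstate : ∀ x, ‖((freeAngle a t x, freeVelocity a t x) : ℝ × ℝ)‖ ≤ κ * ‖x‖ := fun x =>
      max_le ((hfree t).2 x).1 ((hfree t).2 x).2
    have h := hlip ε hε hε1 t ht (freeAngle a t x, freeVelocity a t x)
      (freeAngle a t y, freeVelocity a t y)
      ((hstate x).trans (mul_le_mul_of_nonneg_left hx hκ))
      ((hstate y).trans (mul_le_mul_of_nonneg_left hy hκ))
    rw [Prod.mk_sub_mk, ← freeAngle_sub, ← freeVelocity_sub] at h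
    rw [← sub_smul, norm_smul]
    refine (mul_le_mul (h.trans (mul_le_mul_of_nonneg_left (hstate (x - y)) (by positivity)))
      (hfree t).1 (norm_nonneg _) (by positivity)).trans_eq ?_
    ring
  · intro z
    simp only [ContinuousLinearMap.smulRight_apply]
    exact integral_linearForce_smul_pulledForce ha hf z
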